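/- Let $\kappa, N, k\ge 0$ and $1\le T\le 2^{\kappa}$ be integers, let $X=\{0,1\}^{\kappa}$, let $Y$ be a finite set, let $x_0\in X$, and put $p := T/2^{\kappa}$. Let $h_0,\dots,h_{N-1} : X\times Y\to X$ be independent, uniformly random functions, available through quantum queries $|i,x,y,r\rangle\mapsto|i,x,y,r\oplus h_i(x,y)\rangle$. A sequence $(y_0,\dots,y_{\ell-1})\in Y^{\ell}$ with $\ell\le N$ is a Chain-of-PoWs solution of length $\ell$ if the values defined by $x_{i+1}:=h_i(x_i,y_i)$, $0\le i<\ell$, all lie in the target set consisting of the $T$ elements of $X$ whose binary value is less than $T$ (so a single classical query hits the target with probability $p$). Consider any quantum query adversary $\mathcal A$ with a finite-dimensional workspace: it applies arbitrary oracle-independent unitaries to its registers, makes at most $N$ queries in total between them, and finally measures its registers in the computational basis and outputs a sequence determined by the result. Then the probability, over the choice of the $h_i$ and the measurement, that $\mathcal A$ outputs a Chain-of-PoWs solution of length at least $k$ is at most \[ \exp\!\left(-2k\,\ln\!\left(\frac{k}{e\,(N+k)}\cdot\frac{1}{\sqrt p}\right)\right), \] where for $k=0$ this bound is read as $1$. 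-/

import Mathlib

namespace ChainOfPoWs

noncomputable section

/-- The family of oracles `h_0, …, h_{N-1}`, each `h_i : X × Y → X` with `X = {0,1}^κ`. -/
abbrev Oracles (N κ : ℕ) (Y : Type*) := Fin N → BitVec κ × Y → BitVec κ

/-- Computational basis of the adversary's registers: the index `i` of the queried oracle,
the input `(x, y)`, the response register `r`, and the workspace content `w`. -/
abbrev Register (N κ : ℕ) (Y W : Type*) := (Fin N × BitVec κ × Y) × BitVec κ × W

/-- Pure (not necessarily normalised) states of the adversary. -/
abbrev State (N κ : ℕ) (Y W : Type*) [Fintype Y] [Fintype W] :=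
  EuclideanSpace ℂ (Register N κ Y W)

/-- The permutation `|i, x, y, r, w⟩ ↦ |i, x, y, r ⊕ h_i(x, y), w⟩` of the basis states. -/
def queryPerm {N κ : ℕ} {Y : Type*} (W : Type*) (h : Oracles N κ Y) :
    Equiv.Perm (Register N κ Y W) :=
  Function.Involutive.toPerm
    (fun b => (b.1, b.2.1 ^^^ h b.1.1 b.1.2, b.2.2))
    (fun b => by simp)

/-- The unitary black box for the oracles: the linear extension of `queryPerm`. -/
def queryUnitary {N κ : ℕ} {Y : Type*} [Fintype Y] (W : Type*) [Fintype W]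
    (h : Oracles N κ Y) : State N κ Y W ≃ₗᵢ[ℂ] State N κ Y W :=
  LinearIsometryEquiv.piLpCongrLeft 2 ℂ ℂ (queryPerm W h)

/-- A quantum query adversary with finite-dimensional workspace: a normalised initial state,
the number of queries, the oracle-independent unitaries applied before, between and after the
queries (only those with index at most `queries` are used), and the sequence of elements of `Y`
that is output when the final computational-basis measurement yields a given basis state. -/
structure Adversary (N κ : ℕ) (Y W : Type*) [Fintype Y] [Fintype W] where
  queries : ℕ
  init : State N κ Y W
  norm_init : ‖init‖ = 1
  unitary : ℕ → (State N κ Y W ≃ₗᵢ[ℂ] State N κ Y W)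
  output : Register N κ Y W → List Y

namespace Adversary

variable {N κ : ℕ} {Y W : Type*} [Fintype Y] [Fintype W]

/-- The state right before query number `t + 1`. -/
def stateAfter (A : Adversary N κ Y W) (h : Oracles N κ Y) : ℕ → State N κ Y W
  | 0 => A.unitary 0 A.init
  | t + 1 => A.unitary (t + 1) (queryUnitary W h (A.stateAfter h t))

/-- The state that is measured at the end. -/
def finalState (A : Adversary N κ Y W) (h : Oracles N κ Y) : State N κ Y W :=
  A.stateAfter h A.queries

end Adversary

/-- `IsChainFrom h T i x [y_i, y_{i+1}, …]`: with `x_i = x` and `x_{j+1} = h_j(x_j, y_j)`, all the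
values `x_{i+1}, x_{i+2}, …` belong to the target set, the `T` elements of `{0,1}^κ` whose binary
value is less than `T`. (There must be an oracle for every step, so the indices stay below `N`.) -/
def IsChainFrom {N κ : ℕ} {Y : Type*} (h : Oracles N κ Y) (T : ℕ) :
    ℕ → BitVec κ → List Y → Prop
  | _, _, [] => True
  | i, x, y :: ys => ∃ hi : i < N,
      (h ⟨i, hi⟩ (x, y)).toNat < T ∧ IsChainFrom h T (i + 1) (h ⟨i, hi⟩ (x, y)) ys

/-- `ys` is a Chain-of-PoWs solution of size at least `k` for the start value `x₀`. -/
def IsSolution {N κ : ℕ} {Y : Type*} (h : Oracles N κ Y) (T : ℕ) (x₀ : BitVec κ) (k : ℕ)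
    (ys : List Y) : Prop :=
  k ≤ ys.length ∧ IsChainFrom h T 0 x₀ ys

open Classical in
/-- Success probability for fixed oracles: the Born probability of measuring a basis state whose
associated output is a solution of size at least `k`. -/
def successProbGiven {N κ : ℕ} {Y W : Type*} [Fintype Y] [Fintype W] (A : Adversary N κ Y W)
    (T : ℕ) (x₀ : BitVec κ) (k : ℕ) (h : Oracles N κ Y) : ℝ :=
  ∑ b : Register N κ Y W, if IsSolution h T x₀ k (A.output b) then ‖A.finalState h b‖ ^ 2 else 0

open Classical in
/-- Success probability over independent uniformly random oracles `h_0, …, h_{N-1}`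
(that is, over a uniformly random element of the finite set of oracle families). -/
def successProb {N κ : ℕ} {Y W : Type*} [Fintype Y] [Fintype W] (A : Adversary N κ Y W)
    (T : ℕ) (x₀ : BitVec κ) (k : ℕ) : ℝ :=
  (∑ h : Oracles N κ Y, successProbGiven A T x₀ k h) / (Fintype.card (Oracles N κ Y) : ℝ)

end

end ChainOfPoWs

/-!
Purify the oracles: run the adversary on the uniform superposition of all functions `h`, so that
`h` sits in a register of its own and every query is controlled by it. In this register the
projection `hit T c` onto `h c ∈ T` differs by only `√p` in norm from a projection `known T c` which
vanishes wherever the value at `c` is still in uniform superposition, so that a cell that has not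
been queried never counts.

The operators `known T c` commute, and `progress` multiplies a state by a factor `l ≥ 1` for each
cell that is known to hit the target. It fixes the initial state. Since `hit T c` commutes with a
query, `known T c` commutes with it up to `2 √p`, and a query touches one cell per branch, so it
increases the norm of the progress by a factor of at most `exp (l √p)`. Conversely, each of `k`
links of a chain costs a factor of `p + 1 / l ^ 2`: reading off the cells of a chain from its start
determines in turn which cell comes next, so the projection onto the chains has squared norm at most
`(p + 1 / l ^ 2) ^ k` relative to the progress. Hence `q` queries succeed with probability at most
`(p + 1 / l ^ 2) ^ k * exp (2 q l √p)`, and `l = k / ((q + k) √p)` gives the bound.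
-/

namespace ChainOfPoWs

noncomputable section

section TiltedProjection

variable {A : Type*} [Ring A] [Algebra ℝ A] {J P : A} {p : ℝ}

/-- For projections `J` and `P` of a Hilbert space with `J * P * J = p • J` and `p < 1`, the
projection onto the orthogonal complement of the range of `J` inside the sum of the ranges of `J`
and `P`: it is the projection `P`, tilted away from `J` by an angle with sine `√p`. -/
def tiltedProjection (J P : A) (p : ℝ) : A :=
  P - J + (1 - p)⁻¹ • ((1 - P) * J * (1 - P))

theorem commute_tiltedProjection {O : A} (hJ : Commute J O) (hP : Commute P O) :
    Commute (tiltedProjection J P p) O :=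
  have hQ : Commute (1 - P) O := (Commute.one_left O).sub_left hP
  (hP.sub_left hJ).add_left (((hQ.mul_left hJ).mul_left hQ).smul_left _)

theorem mul_one_sub_mul_eq_smul (hJ : IsIdempotentElem J) (hJPJ : J * P * J = p • J) :
    J * (1 - P) * J = (1 - p) • J := by
  rw [mul_sub, sub_mul, mul_one, hJ.eq, hJPJ, sub_smul, one_smul]

theorem conj_mul_conj_eq_smul (hP : IsIdempotentElem P) (hJPJ : J * P * J = p • J) :
    P * J * P * (P * J * P) = p • (P * J * P) := by
  calc P * J * P * (P * J * P) = P * (J * (P * P) * J) * P := by simp only [mul_assoc]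
    _ = p • (P * J * P) := by rw [hP.eq, hJPJ, mul_smul_comm, smul_mul_assoc]

theorem tiltedProjection_mul_left (hJ : IsIdempotentElem J) (hJPJ : J * P * J = p • J)
    (hp : p < 1) : tiltedProjection J P p * J = 0 := by
  have hq : (1 - p)⁻¹ • ((1 - P) * J * (1 - P) * J) = (1 - P) * J := by
    rw [mul_assoc, mul_assoc, ← mul_assoc J, mul_one_sub_mul_eq_smul hJ hJPJ, mul_smul_comm,
      inv_smul_smul₀ (sub_pos.2 hp).ne']
  rw [tiltedProjection, add_mul, sub_mul, smul_mul_assoc, hq, hJ.eq]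
  noncomm_ring

theorem tiltedProjection_mul_right (hP : IsIdempotentElem P) :
    tiltedProjection J P p * P = P - J * P := by
  rw [tiltedProjection, add_mul, sub_mul, smul_mul_assoc, mul_assoc _ (1 - P),
    hP.one_sub_mul_self, hP.eq, mul_zero, smul_zero, add_zero]

theorem right_mul_tiltedProjection (hP : IsIdempotentElem P) :
    P * tiltedProjection J P p = P - P * J := by
  rw [tiltedProjection, mul_add, mul_sub, mul_smul_comm, mul_assoc (1 - P), ← mul_assoc P (1 - P),
    hP.mul_one_sub_self, hP.eq, zero_mul, smul_zero, add_zero]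

theorem isIdempotentElem_tiltedProjection (hJ : IsIdempotentElem J) (hP : IsIdempotentElem P)
    (hJPJ : J * P * J = p • J) (hp : p < 1) : IsIdempotentElem (tiltedProjection J P p) := by
  set R := tiltedProjection J P p with hR
  have hRJ : R * J = 0 := tiltedProjection_mul_left hJ hJPJ hp
  have hRP : R * P = P - J * P := tiltedProjection_mul_right hP
  have hRQJ : R * (1 - P) * J = (1 - P) * J - (1 - p) • J := by
    rw [sub_smul, one_smul, ← hJPJ, mul_sub, hRP, sub_mul, mul_one, hRJ]
    noncomm_ring
  calc R * R = R * P - R * J + (1 - p)⁻¹ • (R * (1 - P) * J * (1 - P)) := by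
        nth_rewrite 2 [hR]
        rw [tiltedProjection, mul_add, mul_sub, mul_smul_comm, ← mul_assoc, ← mul_assoc]
    _ = P - J * P + ((1 - p)⁻¹ • ((1 - P) * J * (1 - P)) - J * (1 - P)) := by
        rw [hRP, hRJ, hRQJ, sub_zero, sub_mul, smul_sub, smul_mul_assoc,
          inv_smul_smul₀ (sub_pos.2 hp).ne']
    _ = R := by rw [hR, tiltedProjection]; noncomm_ring

theorem tiltedProjection_sub_mul_self (hJ : IsIdempotentElem J) (hP : IsIdempotentElem P)
    (hJPJ : J * P * J = p • J) (hp : p < 1) :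
    (tiltedProjection J P p - P) * (tiltedProjection J P p - P) =
      P * J * P + ((1 - p)⁻¹ - 1) • ((1 - P) * J * (1 - P)) := by
  rw [sub_mul, mul_sub, mul_sub, (isIdempotentElem_tiltedProjection hJ hP hJPJ hp).eq,
    tiltedProjection_mul_right hP, right_mul_tiltedProjection hP, hP.eq, tiltedProjection,
    sub_smul, one_smul]
  noncomm_ring

theorem tiltedProjection_sub_pow_four (hJ : IsIdempotentElem J) (hP : IsIdempotentElem P)
    (hJPJ : J * P * J = p • J) (hp : p < 1) :
    (tiltedProjection J P p - P) * (tiltedProjection J P p - P) *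
        ((tiltedProjection J P p - P) * (tiltedProjection J P p - P)) =
      p • ((tiltedProjection J P p - P) * (tiltedProjection J P p - P)) := by
  have hPQ : P * J * P * ((1 - P) * J * (1 - P)) = 0 := by
    rw [mul_assoc (P * J), mul_assoc (1 - P), ← mul_assoc P (1 - P), hP.mul_one_sub_self, zero_mul,
      mul_zero]
  have hQP : (1 - P) * J * (1 - P) * (P * J * P) = 0 := by
    rw [mul_assoc (_ * _), mul_assoc P, ← mul_assoc (1 - P) P, hP.one_sub_mul_self, zero_mul,
      mul_zero]
  have hcoef : ((1 - p)⁻¹ - 1) * ((1 - p)⁻¹ - 1) * (1 - p) = p * ((1 - p)⁻¹ - 1) := by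
    have := (sub_pos.2 hp).ne'
    field_simp
    ring
  rw [tiltedProjection_sub_mul_self hJ hP hJPJ hp, add_mul, mul_add, mul_add, smul_mul_smul_comm,
    conj_mul_conj_eq_smul hP hJPJ,
    conj_mul_conj_eq_smul hP.one_sub (mul_one_sub_mul_eq_smul hJ hJPJ), mul_smul_comm,
    smul_mul_assoc, hPQ, hQP, smul_zero, add_zero, zero_add, smul_smul, hcoef, smul_add, smul_smul]

theorem isSelfAdjoint_tiltedProjection [StarRing A] [StarModule ℝ A] (hJ : IsSelfAdjoint J)
    (hP : IsSelfAdjoint P) : IsSelfAdjoint (tiltedProjection J P p) := by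
  have hQ : IsSelfAdjoint (1 - P) := (IsSelfAdjoint.one A).sub hP
  refine (hP.sub hJ).add (IsSelfAdjoint.smul (.all _) ?_)
  simpa only [hQ.star_eq] using hJ.conjugate (1 - P)

theorem isStarProjection_tiltedProjection [StarRing A] [StarModule ℝ A] (hJ : IsStarProjection J)
    (hP : IsStarProjection P) (hJPJ : J * P * J = p • J) (hp : p < 1) :
    IsStarProjection (tiltedProjection J P p) where
  isIdempotentElem :=
    isIdempotentElem_tiltedProjection hJ.isIdempotentElem hP.isIdempotentElem hJPJ hp
  isSelfAdjoint := isSelfAdjoint_tiltedProjection hJ.isSelfAdjoint hP.isSelfAdjoint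

theorem norm_tiltedProjection_sub_le {A : Type*} [NormedRing A] [StarRing A] [CStarRing A]
    [NormedAlgebra ℝ A] [StarModule ℝ A] {J P : A} (hJ : IsStarProjection J)
    (hP : IsStarProjection P) (hJPJ : J * P * J = p • J) (hp : 0 ≤ p) (hp1 : p < 1) :
    ‖tiltedProjection J P p - P‖ ≤ √p := by
  set D := tiltedProjection J P p - P
  have hD : IsSelfAdjoint D :=
    (isSelfAdjoint_tiltedProjection hJ.isSelfAdjoint hP.isSelfAdjoint).sub hP.isSelfAdjoint
  have hDD : IsSelfAdjoint (D * D) := by simpa only [hD.star_eq] using IsSelfAdjoint.star_mul_self D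
  have hnorm : ‖D * D‖ ^ 2 = p * ‖D * D‖ := by
    rw [← hDD.norm_mul_self,
      tiltedProjection_sub_pow_four hJ.isIdempotentElem hP.isIdempotentElem hJPJ hp1, norm_smul,
      Real.norm_of_nonneg hp]
  refine Real.le_sqrt_of_sq_le ?_
  rw [← hD.norm_mul_self]
  nlinarith [norm_nonneg (D * D)]

theorem norm_commutator_le {A : Type*} [NormedRing A] {O P : A} (h : Commute P O) (R : A) :
    ‖R * O - O * R‖ ≤ 2 * ‖R - P‖ * ‖O‖ := by
  calc ‖R * O - O * R‖ = ‖(R - P) * O - O * (R - P)‖ := by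
        rw [sub_mul, mul_sub, h.eq, sub_sub_sub_cancel_right]
    _ ≤ ‖R - P‖ * ‖O‖ + ‖O‖ * ‖R - P‖ :=
        (norm_sub_le _ _).trans (add_le_add (norm_mul_le _ _) (norm_mul_le _ _))
    _ = 2 * ‖R - P‖ * ‖O‖ := by ring

end TiltedProjection

section Weight

/-- The element which, for a projection `R`, acts as multiplication by `l` on the range of `R` and
as the identity on its kernel. -/
def weight {A : Type*} [Ring A] [Algebra ℝ A] (R : A) (l : ℝ) : A := 1 + (l - 1) • R

theorem commute_weight {A : Type*} [Ring A] [Algebra ℝ A] {R O : A} {l : ℝ} (h : Commute R O) :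
    Commute (weight R l) O :=
  (Commute.one_left O).add_left (h.smul_left _)

section WeightProd

variable {A ι : Type*} [Ring A] [Algebra ℝ A] {R : ι → A} (hcomm : ∀ i j, Commute (R i) (R j))
  (l : ℝ)

include hcomm in
theorem pairwise_commute_weight (S : Set ι) :
    S.Pairwise (Function.onFun Commute fun i => weight (R i) l) :=
  fun i _ j _ _ => commute_weight (commute_weight (hcomm j i)).symm

/-- The product of the weights of commuting projections `R i`: on joint eigenvectors, it acts as
multiplication by `l ^ m`, where `m` is the number of those `R i`, `i ∈ S`, with eigenvalue `1`. -/
def weightProd (S : Finset ι) : A :=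
  S.noncommProd (fun i => weight (R i) l) (pairwise_commute_weight hcomm l S)

theorem weightProd_empty : weightProd hcomm l ∅ = 1 := Finset.noncommProd_empty _ _

theorem commute_weightProd {S : Finset ι} {O : A} (hO : ∀ i ∈ S, Commute (R i) O) :
    Commute (weightProd hcomm l S) O :=
  (Finset.noncommProd_commute _ _ _ _ fun i hi => (commute_weight (hO i hi)).symm).symm

variable [DecidableEq ι] {S : Finset ι} {i : ι}

theorem weight_mul_weightProd (hi : i ∉ S) :
    weight (R i) l * weightProd hcomm l S = weightProd hcomm l (insert i S) :=
  (Finset.noncommProd_insert_of_notMem S i _ (pairwise_commute_weight hcomm l _) hi).symm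

theorem weight_mul_weightProd_erase (hi : i ∈ S) :
    weight (R i) l * weightProd hcomm l (S.erase i) = weightProd hcomm l S :=
  S.mul_noncommProd_erase hi _ (pairwise_commute_weight hcomm l S)

end WeightProd

variable {H : Type*} [NormedAddCommGroup H] [InnerProductSpace ℂ H] {R : H →L[ℂ] H} {l : ℝ}

theorem weight_apply_of_apply_eq_zero {x : H} (h : R x = 0) : weight R l x = x := by
  simp [weight, h]

theorem weightProd_apply_of_apply_eq_zero {ι : Type*} {R : ι → H →L[ℂ] H}
    (hcomm : ∀ i j, Commute (R i) (R j)) (S : Finset ι) {x : H} (h : ∀ i, R i x = 0) :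
    weightProd hcomm l S x = x := by
  classical
  induction S using Finset.induction with
  | empty => rw [weightProd_empty, one_apply_eq_self]
  | insert i S hi ih =>
    rw [← weight_mul_weightProd hcomm l hi, mul_apply_eq_comp, ih,
      weight_apply_of_apply_eq_zero (h i)]

variable [CompleteSpace H]

theorem norm_sq_eq_add_of_isStarProjection (hR : IsStarProjection R) (x : H) :
    ‖x‖ ^ 2 = ‖(1 - R) x‖ ^ 2 + ‖R x‖ ^ 2 := by
  obtain ⟨K, _, rfl⟩ := isStarProjection_iff_eq_starProjection.1 hR
  rw [K.norm_sq_eq_add_norm_sq_starProjection, add_comm, Submodule.starProjection_orthogonal]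
  rfl

theorem norm_apply_le_of_isStarProjection (hR : IsStarProjection R) (x : H) : ‖R x‖ ≤ ‖x‖ := by
  simpa using R.le_of_opNorm_le hR.norm_le x

theorem norm_weight_sq (hR : IsStarProjection R) (x : H) :
    ‖weight R l x‖ ^ 2 = ‖(1 - R) x‖ ^ 2 + l ^ 2 * ‖R x‖ ^ 2 := by
  have hRw : R * weight R l = l • R := by
    rw [weight, mul_add, mul_one, mul_smul_comm, hR.isIdempotentElem.eq, sub_smul, one_smul,
      add_sub_cancel]
  have hQw : (1 - R) * weight R l = 1 - R := by
    rw [weight, mul_add, mul_one, mul_smul_comm, hR.one_sub_mul_self, smul_zero, add_zero]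
  rw [norm_sq_eq_add_of_isStarProjection hR, ← mul_apply_eq_comp,
    ← mul_apply_eq_comp R, hRw, hQw, smul_apply, norm_smul, mul_pow,
    Real.norm_eq_abs, sq_abs]

theorem norm_le_norm_weight (hR : IsStarProjection R) (hl : 1 ≤ l) (x : H) :
    ‖x‖ ≤ ‖weight R l x‖ := by
  refine le_of_sq_le_sq ?_ (norm_nonneg _)
  rw [norm_weight_sq hR, norm_sq_eq_add_of_isStarProjection hR x]
  gcongr
  exact le_mul_of_one_le_left (sq_nonneg _) (one_le_pow₀ hl)

/-- The shear `(a, s) ↦ (a + θ * s, s)` has norm at most `exp (θ / 2)`. -/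
theorem shear_sq_le {a s θ : ℝ} (ha : 0 ≤ a) (hs : 0 ≤ s) (hθ : 0 ≤ θ) :
    (a + θ * s) ^ 2 + s ^ 2 ≤ Real.exp (θ / 2) ^ 2 * (a ^ 2 + s ^ 2) := by
  have hsinh : θ / 2 ≤ Real.sinh (θ / 2) := Real.self_le_sinh_iff.2 (by positivity)
  rw [Real.sinh_eq, Real.exp_neg] at hsinh
  set g := Real.exp (θ / 2)
  have hg : 0 < g := Real.exp_pos _
  have hθg : θ ≤ g - g⁻¹ := by linarith
  have hg' : 0 ≤ g - g⁻¹ := hθ.trans hθg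
  calc (a + θ * s) ^ 2 + s ^ 2 ≤ (a + (g - g⁻¹) * s) ^ 2 + s ^ 2 := by gcongr
    _ = g ^ 2 * (a ^ 2 + s ^ 2) - (g - g⁻¹) / g * (g * a - s) ^ 2 := by field_simp; ring
    _ ≤ g ^ 2 * (a ^ 2 + s ^ 2) := sub_le_self _ (by positivity)

theorem norm_apply_isometry_le (hR : IsStarProjection R) {O : H →L[ℂ] H}
    (hO : ∀ x, ‖O x‖ = ‖x‖) (x : H) :
    ‖R (O x)‖ ≤ ‖R x‖ + ‖R * O - O * R‖ * ‖(1 - R) x‖ := by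
  have hsplit : R * O = R * (O * R) + R * ((R * O - O * R) * (1 - R)) := by
    have hRR : R * R = R := hR.isIdempotentElem
    have : R * ((R * O - O * R) * (1 - R)) =
        R * R * O - R * R * O * R - R * O * R + R * O * (R * R) := by noncomm_ring
    rw [this, hRR]
    noncomm_ring
  calc ‖R (O x)‖ = ‖R (O (R x)) + R ((R * O - O * R) ((1 - R) x))‖ :=
        congrArg norm (DFunLike.congr_fun hsplit x)
    _ ≤ ‖O (R x)‖ + ‖(R * O - O * R) ((1 - R) x)‖ :=
        norm_add_le_of_le (norm_apply_le_of_isStarProjection hR _)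
          (norm_apply_le_of_isStarProjection hR _)
    _ ≤ ‖R x‖ + ‖R * O - O * R‖ * ‖(1 - R) x‖ :=
        add_le_add (hO _).le (ContinuousLinearMap.le_opNorm _ _)

theorem norm_weight_apply_isometry_le (hR : IsStarProjection R) (hl : 1 ≤ l) {O : H →L[ℂ] H}
    (hO : ∀ x, ‖O x‖ = ‖x‖) (x : H) :
    ‖weight R l (O x)‖ ≤ Real.exp (l * ‖R * O - O * R‖ / 2) * ‖weight R l x‖ := by
  have hl2 : 0 ≤ l ^ 2 - 1 := sub_nonneg.2 (one_le_pow₀ hl)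
  set δ := ‖R * O - O * R‖
  set a := ‖R x‖
  set s := ‖(1 - R) x‖
  have hpyth : ‖(1 - R) (O x)‖ ^ 2 + ‖R (O x)‖ ^ 2 = s ^ 2 + a ^ 2 := by
    rw [← norm_sq_eq_add_of_isStarProjection hR, ← norm_sq_eq_add_of_isStarProjection hR, hO]
  have ha : a ≤ a + δ * s := le_add_of_nonneg_right (by positivity)
  refine le_of_sq_le_sq ?_ (by positivity)
  calc ‖weight R l (O x)‖ ^ 2
      = s ^ 2 + a ^ 2 + (l ^ 2 - 1) * ‖R (O x)‖ ^ 2 := by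
        rw [norm_weight_sq hR, ← hpyth]; ring
    _ ≤ s ^ 2 + (a + δ * s) ^ 2 + (l ^ 2 - 1) * (a + δ * s) ^ 2 := by
        gcongr
        exact norm_apply_isometry_le hR hO x
    _ = (l * a + l * δ * s) ^ 2 + s ^ 2 := by ring
    _ ≤ Real.exp (l * δ / 2) ^ 2 * ((l * a) ^ 2 + s ^ 2) :=
        shear_sq_le (by positivity) (norm_nonneg _) (by positivity)
    _ = (Real.exp (l * δ / 2) * ‖weight R l x‖) ^ 2 := by
        rw [mul_pow _ ‖weight R l x‖, norm_weight_sq hR]; ring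

theorem norm_apply_sq_le_weight (hR : IsStarProjection R) (hl : 0 < l) {P : H →L[ℂ] H}
    (hP : IsStarProjection P) {ε : ℝ} (hRP : ‖R - P‖ ≤ ε) (x : H) :
    ‖P x‖ ^ 2 ≤ (ε ^ 2 + 1 / l ^ 2) * ‖weight R l x‖ ^ 2 := by
  have hsplit : P = P * R - P * ((R - P) * (1 - R)) := by
    have hRR : R * R = R := hR.isIdempotentElem
    have hPP : P * P = P := hP.isIdempotentElem
    have : P * ((R - P) * (1 - R)) = P * R - P * (R * R) - P * P + P * P * R := by noncomm_ring
    rw [this, hRR, hPP]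
    abel
  have hPx : ‖P x‖ ≤ ‖R x‖ + ε * ‖(1 - R) x‖ := by
    calc ‖P x‖ = ‖P (R x) - P ((R - P) ((1 - R) x))‖ := congrArg norm (DFunLike.congr_fun hsplit x)
      _ ≤ ‖R x‖ + ‖(R - P) ((1 - R) x)‖ :=
          norm_sub_le_of_le (norm_apply_le_of_isStarProjection hP _)
            (norm_apply_le_of_isStarProjection hP _)
      _ ≤ ‖R x‖ + ε * ‖(1 - R) x‖ := by
          gcongr
          exact ContinuousLinearMap.le_of_opNorm_le _ hRP _
  calc ‖P x‖ ^ 2 ≤ (‖R x‖ + ε * ‖(1 - R) x‖) ^ 2 := by gcongr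
    _ ≤ (‖R x‖ + ε * ‖(1 - R) x‖) ^ 2 + (ε * l * ‖R x‖ - ‖(1 - R) x‖ / l) ^ 2 :=
        le_add_of_nonneg_right (sq_nonneg _)
    _ = (ε ^ 2 + 1 / l ^ 2) * ‖weight R l x‖ ^ 2 := by
        rw [norm_weight_sq hR]
        field_simp
        ring

theorem norm_le_norm_weightProd {ι : Type*} {R : ι → H →L[ℂ] H}
    (hcomm : ∀ i j, Commute (R i) (R j)) (S : Finset ι)
    (hR : ∀ i, IsStarProjection (R i)) (hl : 1 ≤ l) (x : H) : ‖x‖ ≤ ‖weightProd hcomm l S x‖ := by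
  classical
  induction S using Finset.induction with
  | empty => rw [weightProd_empty, one_apply_eq_self]
  | insert i S hi ih =>
    rw [← weight_mul_weightProd hcomm l hi, mul_apply_eq_comp]
    exact ih.trans (norm_le_norm_weight (hR i) hl _)

end Weight

section Controlled

variable {ι V : Type*} [NormedAddCommGroup V] [InnerProductSpace ℂ V]

/-- The block diagonal operator of `ℓ²(ι, V)` with blocks `D i`: in the tensor picture
`ℓ²(ι) ⊗ V`, the operation `D` on `V` controlled by the basis states of `ℓ²(ι)`. -/
def controlled (D : ι → V →L[ℂ] V) : (PiLp 2 fun _ : ι => V) →L[ℂ] PiLp 2 fun _ : ι => V where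
  toFun F := WithLp.toLp 2 fun i => D i (F i)
  map_add' F G := by ext i; simp
  map_smul' a F := by ext i; simp

theorem controlled_apply (D : ι → V →L[ℂ] V) (F : PiLp 2 fun _ : ι => V) (i : ι) :
    controlled D F i = D i (F i) := rfl

theorem controlled_mul (D E : ι → V →L[ℂ] V) :
    controlled (D * E) = controlled D * controlled E := rfl

theorem commute_controlled {D E : ι → V →L[ℂ] V} (h : Commute D E) :
    Commute (controlled D) (controlled E) := by
  rw [Commute, SemiconjBy, ← controlled_mul, h.eq, controlled_mul]

/-- The projection of `ℓ²(ι, V)` onto the functions supported in `s`. -/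
def restrict (s : Set ι) : (PiLp 2 fun _ : ι => V) →L[ℂ] PiLp 2 fun _ : ι => V :=
  controlled (s.indicator 1)

theorem restrict_apply (s : Set ι) (F : PiLp 2 fun _ : ι => V) (i : ι) :
    restrict s F i = s.indicator F i := by
  by_cases hi : i ∈ s <;> simp [restrict, controlled_apply, hi]

theorem restrict_mul_restrict (s t : Set ι) :
    (restrict s * restrict t : (PiLp 2 fun _ : ι => V) →L[ℂ] _) = restrict (s ∩ t) := by
  ext F i
  by_cases hs : i ∈ s <;> by_cases ht : i ∈ t <;> simp [restrict_apply, hs, ht]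

theorem commute_restrict_controlled (s : Set ι) (D : ι → V →L[ℂ] V) :
    Commute (restrict s) (controlled D) := by
  refine commute_controlled (Pi.commute_iff.2 fun i => ?_)
  by_cases hi : i ∈ s <;> simp [hi]

variable [Fintype ι]

theorem norm_controlled_apply {D : ι → V →L[ℂ] V} (hD : ∀ i v, ‖D i v‖ = ‖v‖)
    (F : PiLp 2 fun _ : ι => V) : ‖controlled D F‖ = ‖F‖ := by
  simp only [PiLp.norm_eq_of_L2, controlled_apply, hD]

theorem isSelfAdjoint_controlled [CompleteSpace V] {D : ι → V →L[ℂ] V}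
    (hD : ∀ i, IsSelfAdjoint (D i)) : IsSelfAdjoint (controlled D) := by
  rw [ContinuousLinearMap.isSelfAdjoint_iff_isSymmetric]
  intro F G
  simp only [PiLp.inner_apply]
  exact Finset.sum_congr rfl fun i _ => (hD i).isSymmetric _ _

theorem isStarProjection_restrict [CompleteSpace V] (s : Set ι) :
    IsStarProjection (restrict s : (PiLp 2 fun _ : ι => V) →L[ℂ] _) where
  isIdempotentElem := by rw [IsIdempotentElem, restrict_mul_restrict, Set.inter_self]
  isSelfAdjoint := isSelfAdjoint_controlled fun i => by by_cases hi : i ∈ s <;> simp [hi]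

theorem norm_restrict_sq (s : Set ι) (F : PiLp 2 fun _ : ι => V) :
    ‖restrict s F‖ ^ 2 = ∑ i, s.indicator (fun i => ‖F i‖ ^ 2) i := by
  rw [PiLp.norm_sq_eq_of_L2]
  refine Finset.sum_congr rfl fun i _ => ?_
  by_cases hi : i ∈ s <;> simp [restrict_apply, hi]

theorem norm_restrict_biUnion_sq {κ : Type*} (T : Finset κ) {s : κ → Set ι}
    (hs : (T : Set κ).PairwiseDisjoint s) (F : PiLp 2 fun _ : ι => V) :
    ‖restrict (⋃ j ∈ T, s j) F‖ ^ 2 = ∑ j ∈ T, ‖restrict (s j) F‖ ^ 2 := by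
  simp only [norm_restrict_sq, Finset.indicator_biUnion_apply T s hs]
  rw [Finset.sum_comm]

theorem norm_sq_eq_sum_norm_restrict_sq {κ : Type*} [Fintype κ] (f : ι → κ)
    (F : PiLp 2 fun _ : ι => V) : ‖F‖ ^ 2 = ∑ j, ‖restrict (f ⁻¹' {j}) F‖ ^ 2 := by
  rw [← norm_restrict_biUnion_sq _ fun i _ j _ hij => ?_]
  · simp [PiLp.norm_sq_eq_of_L2, restrict_apply]
  · exact Disjoint.preimage f (by simpa using hij)

end Controlled

section OracleRegister

open Function

variable {C X V : Type*} [NormedAddCommGroup V] [InnerProductSpace ℂ V]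

/-- Superpositions `∑ h, |h⟩ ⊗ F h` of random functions `h : C → X` in a register of their own,
jointly with a system with state space `V`. -/
abbrev Purified (C X V : Type*) := PiLp 2 fun _ : C → X => V

variable [DecidableEq C] [Fintype X]

/-- The projection onto the states in which the value at `c` is in uniform superposition, and thus
independent of everything else. -/
def average (c : C) : Purified C X V →L[ℂ] Purified C X V where
  toFun F := WithLp.toLp 2 fun h => (Fintype.card X : ℝ)⁻¹ • ∑ z, F (update h c z)
  map_add' F G := by ext h; simp [Finset.sum_add_distrib]
  map_smul' a F := by
    ext h
    simp only [PiLp.smul_apply, ← Finset.smul_sum, RingHom.id_apply, smul_comm _ a]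

theorem average_apply (c : C) (F : Purified C X V) (h : C → X) :
    average c F h = (Fintype.card X : ℝ)⁻¹ • ∑ z, F (update h c z) := rfl

theorem average_update (c : C) (F : Purified C X V) (h : C → X) (z : X) :
    average c F (update h c z) = average c F h := by simp [average_apply]

theorem average_eq_self [Nonempty X] {c : C} {F : Purified C X V}
    (hF : ∀ h z, F (update h c z) = F h) : average c F = F := by
  ext h
  simp [average_apply, hF, ← Nat.cast_smul_eq_nsmul ℝ, smul_smul]

theorem commute_average (c c' : C) :
    Commute (average c : Purified C X V →L[ℂ] _) (average c') := by
  by_cases hc : c = c'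
  · rw [hc]
  ext F h
  simp only [mul_apply_eq_comp, average_apply, ← Finset.smul_sum]
  rw [Finset.sum_comm]
  simp only [update_comm hc]

theorem commute_average_controlled {c : C} {D : (C → X) → V →L[ℂ] V}
    (hD : ∀ h z, D (update h c z) = D h) : Commute (average c) (controlled D) := by
  ext F h
  simp [average_apply, controlled_apply, hD]

theorem commute_average_restrict_eval {c c' : C} (hc : c ≠ c') (s : Set X) :
    Commute (average c : Purified C X V →L[ℂ] _) (restrict (eval c' ⁻¹' s)) := by
  refine commute_average_controlled fun h z => ?_
  have hmem : update h c z ∈ eval c' ⁻¹' s ↔ h ∈ eval c' ⁻¹' s := by simp [update_of_ne hc.symm]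
  by_cases hh : h ∈ eval c' ⁻¹' s
  · rw [Set.indicator_of_mem hh, Set.indicator_of_mem (hmem.2 hh), Pi.one_apply, Pi.one_apply]
  · rw [Set.indicator_of_notMem hh, Set.indicator_of_notMem (hh ∘ hmem.1)]

variable [Fintype C]

theorem isSelfAdjoint_average [CompleteSpace V] (c : C) :
    IsSelfAdjoint (average c : Purified C X V →L[ℂ] _) := by
  have sum_swap (f : (C → X) → X → ℂ) : ∑ h, ∑ z, f h z = ∑ h, ∑ z, f (update h c z) (h c) := by
    have hinv : Involutive fun x : (C → X) × X => (update x.1 c x.2, x.1 c) := fun x => by simp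
    rw [← Fintype.sum_prod_type', ← Fintype.sum_prod_type']
    exact Fintype.sum_equiv hinv.toPerm _ _ fun x => by simp
  rw [ContinuousLinearMap.isSelfAdjoint_iff_isSymmetric]
  intro F G
  simp only [ContinuousLinearMap.coe_coe, PiLp.inner_apply, average_apply,
    inner_smul_left_eq_smul, inner_smul_right_eq_smul, sum_inner, inner_sum, ← Finset.smul_sum]
  rw [sum_swap]
  simp only [update_idem, update_eq_self]

theorem isStarProjection_average [Nonempty X] [CompleteSpace V] (c : C) :
    IsStarProjection (average c : Purified C X V →L[ℂ] _) where
  isIdempotentElem := ContinuousLinearMap.ext fun F => average_eq_self (average_update c F)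
  isSelfAdjoint := isSelfAdjoint_average c

/-- The proportion of elements of `X` that belong to `T`. -/
def density (T : Finset X) : ℝ := T.card / Fintype.card X

theorem density_nonneg (T : Finset X) : 0 ≤ density T :=
  div_nonneg (Nat.cast_nonneg _) (Nat.cast_nonneg _)

/-- The projection onto the functions whose value at `c` belongs to `T`. -/
abbrev hit (T : Finset X) (c : C) : Purified C X V →L[ℂ] Purified C X V :=
  restrict (eval c ⁻¹' T)

theorem average_mul_hit_mul_average (T : Finset X) (c : C) :
    average c * hit T c * average c = density T • (average c : Purified C X V →L[ℂ] _) := by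
  classical
  ext F h
  simp only [mul_apply_eq_comp, smul_apply, PiLp.smul_apply]
  rw [average_apply]
  simp [restrict_apply, Set.indicator_apply, average_update, Finset.sum_ite_mem,
    ← Nat.cast_smul_eq_nsmul ℝ, smul_smul, density, div_eq_inv_mul]

/-- The projection onto the states in which the value at `c` is known to belong to `T`. As opposed
to `hit T c`, from which it differs by at most `√(density T)`, it vanishes where the value at `c`
is still in uniform superposition. -/
def known (T : Finset X) (c : C) : Purified C X V →L[ℂ] Purified C X V :=
  tiltedProjection (average c) (hit T c) (density T)

section Known

variable {T : Finset X}

theorem commute_known_controlled {c : C} {D : (C → X) → V →L[ℂ] V}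
    (hD : ∀ h z, D (update h c z) = D h) : Commute (known T c) (controlled D) :=
  commute_tiltedProjection (commute_average_controlled hD) (commute_restrict_controlled _ _)

theorem commute_known_restrict_eval {c c' : C} (hc : c ≠ c') (s : Set X) :
    Commute (known T c : Purified C X V →L[ℂ] _) (restrict (eval c' ⁻¹' s)) :=
  commute_tiltedProjection (commute_average_restrict_eval hc s) (commute_restrict_controlled _ _)

theorem commute_known (c c' : C) :
    Commute (known T c : Purified C X V →L[ℂ] _) (known T c') := by
  obtain rfl | hc := eq_or_ne c c'
  · exact Commute.refl _
  have haverage : Commute (known T c' : Purified C X V →L[ℂ] _) (average c) :=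
    commute_tiltedProjection (commute_average c' c) (commute_average_restrict_eval hc _).symm
  have hhit : Commute (known T c' : Purified C X V →L[ℂ] _) (hit T c) :=
    commute_known_restrict_eval hc.symm _
  exact commute_tiltedProjection haverage.symm hhit.symm

variable [Nonempty X] [CompleteSpace V]

theorem isStarProjection_known (hT : density T < 1) (c : C) :
    IsStarProjection (known T c : Purified C X V →L[ℂ] _) :=
  isStarProjection_tiltedProjection (isStarProjection_average c) (isStarProjection_restrict _)
    (average_mul_hit_mul_average T c) hT

theorem known_apply_eq_zero (hT : density T < 1) {c : C} {F : Purified C X V}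
    (hF : ∀ h z, F (update h c z) = F h) : known T c F = 0 := by
  have hzero : known T c * average c = (0 : Purified C X V →L[ℂ] _) :=
    tiltedProjection_mul_left (isStarProjection_average c).isIdempotentElem
      (average_mul_hit_mul_average T c) hT
  rw [← average_eq_self hF, ← mul_apply_eq_comp, hzero, zero_apply]

theorem norm_known_sub_hit_le (hT : density T < 1) (c : C) :
    ‖(known T c - hit T c : Purified C X V →L[ℂ] _)‖ ≤ √(density T) :=
  norm_tiltedProjection_sub_le (isStarProjection_average c) (isStarProjection_restrict _)
    (average_mul_hit_mul_average T c) (density_nonneg T) hT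

end Known

end OracleRegister

section Progress

open Function

variable {C X V : Type*} [DecidableEq C] [Fintype C] [Fintype X] [NormedAddCommGroup V]
  [InnerProductSpace ℂ V] {T : Finset X} {l : ℝ} {S : Finset C} {c : C}

/-- On joint eigenvectors of the commuting projections `known T c`, multiplication by `l ^ m`, where
`m` is the number of cells `c ∈ S` whose value is known to belong to `T`: its growth measures the
progress of an adversary. -/
def progress (T : Finset X) (l : ℝ) (S : Finset C) : Purified C X V →L[ℂ] Purified C X V :=
  weightProd commute_known (A := Purified C X V →L[ℂ] Purified C X V) (R := known T) l S

theorem commute_progress {O : Purified C X V →L[ℂ] Purified C X V}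
    (hO : ∀ c ∈ S, Commute (known T c) O) : Commute (progress T l S) O :=
  commute_weightProd _ l hO

theorem progress_apply (hc : c ∈ S) (F : Purified C X V) :
    progress T l S F = weight (known T c) l (progress T l (S.erase c) F) := by
  rw [progress, ← weight_mul_weightProd_erase _ l hc, mul_apply_eq_comp, progress]

theorem norm_progress_controlled_isometry (U : V ≃ₗᵢ[ℂ] V) (F : Purified C X V) :
    ‖progress T l S (controlled (fun _ => (U.toContinuousLinearEquiv : V →L[ℂ] V)) F)‖ =
      ‖progress T l S F‖ := by
  have hcomm : Commute (progress T l S) (controlled fun _ => U.toContinuousLinearEquiv :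
      Purified C X V →L[ℂ] Purified C X V) :=
    commute_progress fun _ _ => commute_known_controlled fun _ _ => rfl
  rw [← mul_apply_eq_comp, hcomm.eq, mul_apply_eq_comp, norm_controlled_apply fun _ => U.norm_map]

variable [Nonempty X] [CompleteSpace V]

theorem progress_apply_eq_self (hT : density T < 1) (S : Finset C) {F : Purified C X V}
    (hF : ∀ c h z, F (update h c z) = F h) : progress T l S F = F :=
  weightProd_apply_of_apply_eq_zero _ _ fun c => known_apply_eq_zero hT (hF c)

theorem norm_le_norm_progress (hT : density T < 1) (hl : 1 ≤ l) (S : Finset C)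
    (F : Purified C X V) : ‖F‖ ≤ ‖progress T l S F‖ :=
  norm_le_norm_weightProd _ _ (isStarProjection_known hT) hl F

theorem norm_hit_progress_erase_sq_le (hT : density T < 1) (hl : 0 < l) (hc : c ∈ S)
    (F : Purified C X V) :
    ‖hit T c (progress T l (S.erase c) F)‖ ^ 2 ≤
      (density T + 1 / l ^ 2) * ‖progress T l S F‖ ^ 2 := by
  rw [progress_apply hc, ← Real.sq_sqrt (density_nonneg T)]
  exact norm_apply_sq_le_weight (H := Purified C X V) (isStarProjection_known hT c) hl
    (isStarProjection_restrict _) (norm_known_sub_hit_le hT c) _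

theorem norm_restrict_hit_sq_le (hT : density T < 1) (hl : 0 < l) (hc : c ∈ S)
    {s : X → Set (C → X)} {B : ℝ} (hB : 0 ≤ B)
    (hs : ∀ z ∈ T, ∀ F : Purified C X V,
      ‖restrict (s z) F‖ ^ 2 ≤ B * ‖progress T l (S.erase c) F‖ ^ 2)
    (F : Purified C X V) :
    ‖restrict {h | h c ∈ T ∧ h ∈ s (h c)} F‖ ^ 2 ≤
      B * ((density T + 1 / l ^ 2) * ‖progress T l S F‖ ^ 2) := by
  have hdisj : Pairwise (Disjoint on fun z => {h : C → X | h c = z}) := fun z w hzw =>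
    Set.disjoint_left.2 fun h hz hw => hzw (hz.symm.trans hw)
  have hunion : {h | h c ∈ T ∧ h ∈ s (h c)} = ⋃ z ∈ T, s z ∩ {h | h c = z} := by
    ext h
    simp [and_comm]
  have hhit : eval c ⁻¹' (T : Set X) = ⋃ z ∈ T, {h : C → X | h c = z} := by
    ext h
    simp
  have hcomm (z : X) : Commute (progress T l (S.erase c))
      (restrict {h | h c = z} : Purified C X V →L[ℂ] Purified C X V) :=
    commute_progress fun c' hc' => commute_known_restrict_eval (Finset.ne_of_mem_erase hc') {z}
  calc ‖restrict {h | h c ∈ T ∧ h ∈ s (h c)} F‖ ^ 2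
      = ∑ z ∈ T, ‖restrict (s z) (restrict {h | h c = z} F)‖ ^ 2 := by
        rw [hunion, norm_restrict_biUnion_sq T fun z _ w _ hzw => (hdisj hzw).mono
          Set.inter_subset_right Set.inter_subset_right]
        simp only [← mul_apply_eq_comp, restrict_mul_restrict]
    _ ≤ ∑ z ∈ T, B * ‖progress T l (S.erase c) (restrict {h | h c = z} F)‖ ^ 2 :=
        Finset.sum_le_sum fun z hz => hs z hz _
    _ = B * ‖hit T c (progress T l (S.erase c) F)‖ ^ 2 := by
        rw [hit, hhit, norm_restrict_biUnion_sq T fun z _ w _ hzw => hdisj hzw, Finset.mul_sum]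
        simp only [← mul_apply_eq_comp, (hcomm _).eq]
    _ ≤ B * ((density T + 1 / l ^ 2) * ‖progress T l S F‖ ^ 2) :=
        mul_le_mul_of_nonneg_left (norm_hit_progress_erase_sq_le hT hl hc F) hB

theorem norm_weight_controlled_le (hT : density T < 1) (hl : 1 ≤ l) (c : C)
    {D : (C → X) → V →L[ℂ] V} (hD : ∀ h v, ‖D h v‖ = ‖v‖) (F : Purified C X V) :
    ‖weight (known T c) l (controlled D F)‖ ≤
      Real.exp (l * √(density T)) * ‖weight (known T c) l F‖ := by
  have hnorm : ‖controlled D‖ ≤ 1 :=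
    (controlled D).opNorm_le_bound zero_le_one fun G => by rw [norm_controlled_apply hD, one_mul]
  have hcomm : ‖known T c * controlled D - controlled D * known T c‖ ≤ 2 * √(density T) := by
    calc _ ≤ 2 * ‖known T c - hit T c‖ * ‖controlled D‖ :=
          norm_commutator_le (commute_restrict_controlled _ D) _
      _ ≤ 2 * √(density T) * 1 := by
          gcongr
          exact norm_known_sub_hit_le hT c
      _ = 2 * √(density T) := mul_one _
  refine (norm_weight_apply_isometry_le (isStarProjection_known hT c) hl
    (norm_controlled_apply hD) F).trans ?_
  gcongr
  linarith [mul_le_mul_of_nonneg_left hcomm (zero_le_one.trans hl)]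

end Progress

section QueryLocality

open Function

variable {C X B : Type*} [DecidableEq C] [Fintype C] [Fintype X] [Fintype B]
  {T : Finset X} {l : ℝ}

/-- The projection of the system onto the span of the basis vectors in `s`, as an operator on the
purified states. -/
abbrev measured (C X : Type*) [Fintype C] (s : Set B) :
    Purified C X (EuclideanSpace ℂ B) →L[ℂ] Purified C X (EuclideanSpace ℂ B) :=
  controlled fun _ => restrict s

theorem norm_sq_eq_sum_norm_measured_sq {κ : Type*} [Fintype κ] (f : B → κ)
    (F : Purified C X (EuclideanSpace ℂ B)) :
    ‖F‖ ^ 2 = ∑ j, ‖measured C X (f ⁻¹' {j}) F‖ ^ 2 := by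
  simp only [PiLp.norm_sq_eq_of_L2 _ (_ : Purified C X _), controlled_apply]
  rw [Finset.sum_comm]
  exact Finset.sum_congr rfl fun h _ => norm_sq_eq_sum_norm_restrict_sq f (F h)

theorem commute_progress_measured (S : Finset C) (s : Set B) :
    Commute (progress (V := EuclideanSpace ℂ B) T l S) (measured C X s) :=
  commute_progress fun _ _ => commute_known_controlled fun _ _ => rfl

theorem measured_progress {S : Finset C} {c : C} (hc : c ∈ S) (s : Set B)
    (F : Purified C X (EuclideanSpace ℂ B)) :
    measured C X s (progress T l S F) =
      weight (known T c) l (measured C X s (progress T l (S.erase c) F)) := by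
  have hknown : Commute (known (V := EuclideanSpace ℂ B) T c) (measured C X s) :=
    commute_known_controlled fun _ _ => rfl
  have hweight : Commute (weight (known (V := EuclideanSpace ℂ B) T c) l) (measured C X s) :=
    commute_weight hknown
  rw [progress_apply hc]
  exact (DFunLike.congr_fun hweight.eq (progress T l (S.erase c) F)).symm

theorem measured_progress_controlled {S : Finset C} {c : C} (hc : c ∈ S) {s : Set B}
    {D : (C → X) → EuclideanSpace ℂ B →L[ℂ] EuclideanSpace ℂ B}
    (hcomm : ∀ h, Commute (restrict s) (D h))
    (hloc : ∀ c' ≠ c, ∀ h z, restrict s * D (update h c' z) = restrict s * D h)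
    (F : Purified C X (EuclideanSpace ℂ B)) :
    measured C X s (progress T l S (controlled D F)) =
      weight (known T c) l (controlled D (measured C X s (progress T l (S.erase c) F))) := by
  have hprogress := commute_progress_measured (X := X) (T := T) (l := l) (S.erase c) s
  have hprogress' : Commute (progress (V := EuclideanSpace ℂ B) T l (S.erase c))
      (measured C X s * controlled D) := by
    rw [← controlled_mul]
    exact commute_progress fun c' hc' =>
      commute_known_controlled (hloc c' (Finset.ne_of_mem_erase hc'))
  have hmeasured : Commute (measured C X s) (controlled D) :=
    commute_controlled (Pi.commute_iff.2 hcomm)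
  rw [measured_progress hc]
  congr 1
  exact DFunLike.congr_fun (show measured C X s * (progress T l (S.erase c) * controlled D) =
      controlled D * (measured C X s * progress T l (S.erase c)) by
    rw [← mul_assoc, ← hprogress.eq, mul_assoc, hprogress'.eq, hmeasured.eq, mul_assoc,
      hprogress.eq]) F

theorem norm_progress_controlled_le [Nonempty X] (hT : density T < 1) (hl : 1 ≤ l) (f : B → C)
    {D : (C → X) → EuclideanSpace ℂ B →L[ℂ] EuclideanSpace ℂ B} (hD : ∀ h v, ‖D h v‖ = ‖v‖)
    (hcomm : ∀ c h, Commute (restrict (f ⁻¹' {c})) (D h))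
    (hloc : ∀ c, ∀ c' ≠ c, ∀ h z,
      restrict (f ⁻¹' {c}) * D (update h c' z) = restrict (f ⁻¹' {c}) * D h)
    (F : Purified C X (EuclideanSpace ℂ B)) :
    ‖progress T l Finset.univ (controlled D F)‖ ≤
      Real.exp (l * √(density T)) * ‖progress T l Finset.univ F‖ := by
  refine le_of_sq_le_sq ?_ (by positivity)
  rw [mul_pow, norm_sq_eq_sum_norm_measured_sq f,
    norm_sq_eq_sum_norm_measured_sq f (progress T l Finset.univ F), Finset.mul_sum]
  refine Finset.sum_le_sum fun c _ => ?_
  rw [← mul_pow, measured_progress_controlled (Finset.mem_univ c) (hcomm c) (hloc c),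
    measured_progress (Finset.mem_univ c)]
  exact pow_le_pow_left₀ (norm_nonneg _) (norm_weight_controlled_le hT hl c hD _) 2

end QueryLocality

section Joint

open Function

/-- The inputs of the oracles. -/
abbrev Cell (N κ : ℕ) (Y : Type*) := Fin N × BitVec κ × Y

/-- The set of bit strings whose binary value is less than `t`. -/
def target (κ t : ℕ) : Finset (BitVec κ) := Finset.univ.filter fun z => z.toNat < t

theorem setOf_isChainFrom_cons {N κ t i : ℕ} {Y : Type*} (hi : i < N) (x : BitVec κ) (y : Y)
    (ys : List Y) :
    {h : Cell N κ Y → BitVec κ | IsChainFrom (curry h) t i x (y :: ys)} =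
      {h | h (⟨i, hi⟩, x, y) ∈ target κ t ∧
        h ∈ (fun z => {h : Cell N κ Y → BitVec κ | IsChainFrom (curry h) t (i + 1) z ys})
          (h (⟨i, hi⟩, x, y))} := by
  ext h
  simp only [Set.mem_ofPred_eq, IsChainFrom, target, Finset.mem_filter_univ]
  exact exists_prop_of_true hi

variable {N κ : ℕ} {Y W : Type*} [Fintype Y] [Fintype W]

/-- The unitary black box as a continuous linear operator. -/
def queryOperator (W : Type*) [Fintype W] (h : Oracles N κ Y) : State N κ Y W →L[ℂ] State N κ Y W :=
  (queryUnitary W h).toContinuousLinearEquiv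

theorem queryOperator_apply (h : Oracles N κ Y) (v : State N κ Y W) (b : Register N κ Y W) :
    queryOperator W h v b = v (b.1, b.2.1 ^^^ h b.1.1 b.1.2, b.2.2) := rfl

theorem norm_queryOperator_apply (h : Oracles N κ Y) (v : State N κ Y W) :
    ‖queryOperator W h v‖ = ‖v‖ := (queryUnitary W h).norm_map v

theorem commute_restrict_queryOperator (c : Cell N κ Y) (h : Oracles N κ Y) :
    Commute (restrict (Prod.fst ⁻¹' {c})) (queryOperator W h) := by
  ext v b
  by_cases hb : b.1 = c <;> simp [restrict_apply, queryOperator_apply, hb]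

theorem restrict_mul_queryOperator_congr {c : Cell N κ Y} {h h' : Oracles N κ Y}
    (hc : h c.1 c.2 = h' c.1 c.2) :
    restrict (Prod.fst ⁻¹' {c}) * queryOperator W h =
      restrict (Prod.fst ⁻¹' {c}) * queryOperator W h' := by
  ext v b
  by_cases hb : b.1 = c <;> simp [restrict_apply, queryOperator_apply, hb, hc]

theorem norm_stateAfter (A : Adversary N κ Y W) (h : Oracles N κ Y) (n : ℕ) :
    ‖A.stateAfter h n‖ = 1 := by
  induction n with
  | zero => rw [Adversary.stateAfter, LinearIsometryEquiv.norm_map, A.norm_init]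
  | succ n ih =>
    rw [Adversary.stateAfter, LinearIsometryEquiv.norm_map, LinearIsometryEquiv.norm_map, ih]

theorem successProbGiven_le_one (A : Adversary N κ Y W) (t : ℕ) (x₀ : BitVec κ) (k : ℕ)
    (h : Oracles N κ Y) : successProbGiven A t x₀ k h ≤ 1 := by
  classical
  calc successProbGiven A t x₀ k h ≤ ∑ b, ‖A.finalState h b‖ ^ 2 :=
        Finset.sum_le_sum fun b _ => (ite_le_sup ..).trans (sup_le le_rfl (sq_nonneg _))
    _ = 1 := by
        rw [← PiLp.norm_sq_eq_of_L2, Adversary.finalState, norm_stateAfter, one_pow]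

theorem successProb_le_one (A : Adversary N κ Y W) (t : ℕ) (x₀ : BitVec κ) (k : ℕ) :
    successProb A t x₀ k ≤ 1 :=
  div_le_one_of_le₀ ((Finset.sum_le_card_nsmul _ _ 1 fun h _ =>
    successProbGiven_le_one A t x₀ k h).trans_eq (by simp)) (Nat.cast_nonneg _)

/-- Joint states of the oracles and the adversary. -/
abbrev Joint (N κ : ℕ) (Y W : Type*) [Fintype Y] [Fintype W] :=
  Purified (Cell N κ Y) (BitVec κ) (State N κ Y W)

/-- The query operator on the joint states. -/
def jointQuery (N κ : ℕ) (Y W : Type*) [Fintype Y] [Fintype W] :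
    Joint N κ Y W →L[ℂ] Joint N κ Y W :=
  controlled fun h => queryOperator W (curry h)

/-- The joint state right before query number `n + 1`, with the oracles in uniform superposition
(not normalised: every `h` has amplitude `1`). -/
def jointState (A : Adversary N κ Y W) (n : ℕ) : Joint N κ Y W :=
  WithLp.toLp 2 fun h => A.stateAfter (curry h) n

theorem jointState_succ (A : Adversary N κ Y W) (n : ℕ) :
    jointState A (n + 1) =
      controlled (fun _ => ((A.unitary (n + 1)).toContinuousLinearEquiv : _ →L[ℂ] _))
        (jointQuery N κ Y W (jointState A n)) := rfl

variable {t : ℕ} {T : Finset (BitVec κ)} {l : ℝ}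

section DecidableEq

variable [DecidableEq Y]

theorem norm_jointState_sq (A : Adversary N κ Y W) (n : ℕ) :
    ‖jointState A n‖ ^ 2 = Fintype.card (Cell N κ Y → BitVec κ) := by
  rw [PiLp.norm_sq_eq_of_L2]
  simp [jointState, norm_stateAfter]

theorem norm_progress_jointQuery_le (hT : density T < 1) (hl : 1 ≤ l) (F : Joint N κ Y W) :
    ‖progress T l Finset.univ (jointQuery N κ Y W F)‖ ≤
      Real.exp (l * √(density T)) * ‖progress T l Finset.univ F‖ := by
  refine norm_progress_controlled_le (B := Register N κ Y W) hT hl Prod.fst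
    (D := fun h => queryOperator W (curry h)) (fun h => norm_queryOperator_apply (curry h))
    (fun c h => commute_restrict_queryOperator c (curry h))
    (fun c c' hc h z => restrict_mul_queryOperator_congr ?_) F
  exact update_of_ne hc.symm z h

theorem norm_progress_jointState_le (A : Adversary N κ Y W) (hT : density T < 1) (hl : 1 ≤ l)
    (n : ℕ) : ‖progress T l Finset.univ (jointState A n)‖ ≤
      Real.exp (l * √(density T)) ^ n * ‖jointState A 0‖ := by
  induction n with
  | zero =>
    have hself : progress T l Finset.univ (jointState A 0) = jointState A 0 :=
      progress_apply_eq_self (C := Cell N κ Y) hT _ fun _ _ _ => rfl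
    rw [hself, pow_zero, one_mul]
  | succ n ih =>
    rw [jointState_succ, norm_progress_controlled_isometry, pow_succ', mul_assoc]
    exact (norm_progress_jointQuery_le hT hl _).trans
      (mul_le_mul_of_nonneg_left ih (Real.exp_pos _).le)

theorem norm_restrict_isChainFrom_sq_le (hT : density (target κ t) < 1) (hl : 1 ≤ l) {k i : ℕ}
    (x : BitVec κ) {ys : List Y} (hk : k ≤ ys.length) {S : Finset (Cell N κ Y)}
    (hS : ∀ c : Cell N κ Y, i ≤ c.1 → c ∈ S) (F : Joint N κ Y W) :
    ‖restrict {h | IsChainFrom (curry h) t i x ys} F‖ ^ 2 ≤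
      (density (target κ t) + 1 / l ^ 2) ^ k * ‖progress (target κ t) l S F‖ ^ 2 := by
  have hs : 0 ≤ density (target κ t) + 1 / l ^ 2 :=
    add_nonneg (density_nonneg _) (by positivity)
  induction k generalizing i x ys S F with
  | zero =>
    rw [pow_zero, one_mul]
    refine pow_le_pow_left₀ (norm_nonneg _) ?_ 2
    exact (norm_apply_le_of_isStarProjection (H := Joint N κ Y W)
      (isStarProjection_restrict _) F).trans (norm_le_norm_progress hT hl S F)
  | succ k ih =>
    obtain _ | ⟨y, ys⟩ := ys
    · simp at hk
    by_cases hi : i < N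
    · have hS' : ∀ c : Cell N κ Y, i + 1 ≤ c.1 → c ∈ S.erase (⟨i, hi⟩, x, y) := fun c hc =>
        Finset.mem_erase.2 ⟨fun e => by simp [e] at hc, hS c (by omega)⟩
      rw [setOf_isChainFrom_cons hi, pow_succ (_ + _), mul_assoc]
      exact norm_restrict_hit_sq_le hT (zero_lt_one.trans_le hl) (hS (⟨i, hi⟩, x, y) le_rfl)
        (pow_nonneg hs k) (fun z _ G => ih z (by simpa using hk) hS' G) F
    · have hempty : {h : Cell N κ Y → BitVec κ | IsChainFrom (curry h) t i x (y :: ys)} = ∅ := by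
        ext h
        simp [IsChainFrom, hi]
      rw [hempty, norm_restrict_sq]
      simp only [Set.indicator_empty, Finset.sum_const_zero]
      positivity

theorem sum_successProbGiven_le (A : Adversary N κ Y W) (hT : density (target κ t) < 1)
    (hl : 1 ≤ l) (x₀ : BitVec κ) (k : ℕ) :
    ∑ h : Cell N κ Y → BitVec κ, successProbGiven A t x₀ k (curry h) ≤
      (density (target κ t) + 1 / l ^ 2) ^ k *
        ‖progress (target κ t) l Finset.univ (jointState A A.queries)‖ ^ 2 := by
  classical
  have hs : 0 ≤ density (target κ t) + 1 / l ^ 2 :=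
    add_nonneg (density_nonneg _) (by positivity)
  set Ψ := jointState A A.queries
  unfold successProbGiven
  rw [Finset.sum_comm, norm_sq_eq_sum_norm_measured_sq (id : Register N κ Y W → _),
    Finset.mul_sum]
  refine Finset.sum_le_sum fun b _ => ?_
  by_cases hk : k ≤ (A.output b).length
  · have hcomm := DFunLike.congr_fun (commute_progress_measured (T := target κ t) (l := l)
      (C := Cell N κ Y) Finset.univ (id ⁻¹' {b})).eq Ψ
    calc _ = ‖restrict {h | IsChainFrom (curry h) t 0 x₀ (A.output b)}
          (measured (Cell N κ Y) (BitVec κ) (id ⁻¹' {b}) Ψ)‖ ^ 2 := by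
          rw [norm_restrict_sq]
          refine Finset.sum_congr rfl fun h _ => ?_
          simp only [IsSolution, hk, true_and, Set.indicator_apply, Set.mem_ofPred_eq]
          rw [controlled_apply, norm_restrict_sq]
          simp [Set.indicator_apply, Ψ, jointState, Adversary.finalState]
      _ ≤ _ := norm_restrict_isChainFrom_sq_le hT hl x₀ hk (fun c _ => Finset.mem_univ c) _
      _ = _ := by rw [← mul_apply_eq_comp, hcomm, mul_apply_eq_comp]
  · simp only [IsSolution, hk, false_and, if_false, Finset.sum_const_zero]
    positivity

end DecidableEq

theorem successProb_le (A : Adversary N κ Y W) (hT : density (target κ t) < 1) (hl : 1 ≤ l)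
    (x₀ : BitVec κ) (k : ℕ) :
    successProb A t x₀ k ≤ (density (target κ t) + 1 / l ^ 2) ^ k *
      Real.exp (l * √(density (target κ t))) ^ (2 * A.queries) := by
  classical
  have hs : 0 ≤ density (target κ t) + 1 / l ^ 2 :=
    add_nonneg (density_nonneg _) (by positivity)
  have hpos : (0 : ℝ) < Fintype.card (Cell N κ Y → BitVec κ) :=
    Nat.cast_pos.2 Fintype.card_pos
  have hcard : ∀ inst : Fintype (Oracles N κ Y),
      (@Fintype.card (Oracles N κ Y) inst : ℝ) = Fintype.card (Cell N κ Y → BitVec κ) := fun inst =>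
    congrArg Nat.cast (Fintype.card_congr (Equiv.curry _ _ _).symm)
  have hsum : ∀ inst : Fintype (Oracles N κ Y),
      ∑ h ∈ @Finset.univ (Oracles N κ Y) inst, successProbGiven A t x₀ k h =
        ∑ h : Cell N κ Y → BitVec κ, successProbGiven A t x₀ k (curry h) := fun inst =>
    (Fintype.sum_equiv (Equiv.curry _ _ _) _ _ fun h => rfl).symm
  unfold successProb
  rw [hsum, hcard, div_le_iff₀ hpos]
  calc _ ≤ _ := sum_successProbGiven_le A hT hl x₀ k
    _ ≤ (density (target κ t) + 1 / l ^ 2) ^ k *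
        (Real.exp (l * √(density (target κ t))) ^ A.queries * ‖jointState A 0‖) ^ 2 := by
        gcongr
        exact norm_progress_jointState_le A hT hl _
    _ = _ := by rw [mul_pow, norm_jointState_sq, ← pow_mul, mul_comm 2, mul_assoc]

end Joint

section Bound

theorem density_target {κ t : ℕ} (ht : t ≤ 2 ^ κ) : density (target κ t) = t / 2 ^ κ := by
  have htarget : (target κ t).card = t := by
    rw [← Finset.card_range t]
    refine Finset.card_bij (fun z _ => z.toNat) (fun z hz => by simpa [target] using hz)
      (fun a _ b _ hab => BitVec.eq_of_toNat_eq hab) fun n hn => ?_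
    have hn' : n < t := Finset.mem_range.1 hn
    have hof : (BitVec.ofNat κ n).toNat = n := by
      rw [BitVec.toNat_ofNat, Nat.mod_eq_of_lt (hn'.trans_le ht)]
    exact ⟨BitVec.ofNat κ n, by simp [target, hof, hn'], hof⟩
  have hcard : Fintype.card (BitVec κ) = 2 ^ κ := by
    rw [← FinEnum.card_eq_fintypeCard, FinEnum.card_bitVec]
  rw [density, htarget, hcard, Nat.cast_pow, Nat.cast_ofNat]

theorem one_add_sq_mul_exp_le {u : ℝ} (hu : 0 ≤ u) :
    (1 + u ^ 2) * Real.exp (2 * (1 - u)) ≤ Real.exp 2 := by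
  have hexp : 1 + u ^ 2 ≤ Real.exp (2 * u) :=
    calc 1 + u ^ 2 ≤ (u + 1) ^ 2 := by nlinarith
      _ ≤ Real.exp u ^ 2 := by gcongr; exact Real.add_one_le_exp u
      _ = Real.exp (2 * u) := by rw [← Real.exp_nat_mul, Nat.cast_ofNat]
  calc (1 + u ^ 2) * Real.exp (2 * (1 - u)) ≤ Real.exp (2 * u) * Real.exp (2 * (1 - u)) := by
        gcongr
    _ = Real.exp 2 := by rw [← Real.exp_add]; ring_nf

theorem exp_neg_two_mul_log {x : ℝ} (hx : 0 < x) (k : ℕ) :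
    Real.exp (-2 * k * Real.log x) = (1 / x ^ 2) ^ k := by
  have hlog : -2 * k * Real.log x = k * -(2 * Real.log x) := by ring
  rw [hlog, Real.exp_nat_mul, Real.exp_neg, ← Nat.cast_ofNat, Real.exp_nat_mul, Real.exp_log hx,
    one_div]

theorem add_pow_mul_exp_pow_le {p l : ℝ} (hp : 0 < p) {q k m : ℕ} (hk : k ≠ 0) (hm : m ≤ q)
    (hl : l = k / ((q + k) * √p)) :
    (p + 1 / l ^ 2) ^ k * Real.exp (l * √p) ^ (2 * m) ≤
      Real.exp (-2 * k * Real.log (k / (Real.exp 1 * (q + k)) * (1 / √p))) := by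
  set u : ℝ := k / (q + k) with hu
  have hu0 : 0 < u := by positivity
  have hlp : l * √p = u := by rw [hl, hu]; field_simp
  have hadd : p + 1 / l ^ 2 = p / u ^ 2 * (1 + u ^ 2) := by
    have hl0 : l ≠ 0 := left_ne_zero_of_mul (hlp.trans_ne hu0.ne')
    rw [← hlp, mul_pow, Real.sq_sqrt hp.le]
    field_simp
    ring
  have hexp : Real.exp (l * √p) ^ (2 * m) ≤ Real.exp (2 * (1 - u)) ^ k := by
    rw [hlp, ← Real.exp_nat_mul, ← Real.exp_nat_mul, Real.exp_le_exp]
    calc ((2 * m : ℕ) : ℝ) * u ≤ (2 * q : ℕ) * u := by gcongr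
      _ = k * (2 * (1 - u)) := by rw [hu, Nat.cast_mul, Nat.cast_ofNat]; field_simp; ring
  have htarget : 1 / (k / (Real.exp 1 * (q + k)) * (1 / √p)) ^ 2 = p / u ^ 2 * Real.exp 2 := by
    have hexp2 : Real.exp 2 = Real.exp 1 ^ 2 := by rw [← Real.exp_nat_mul]; norm_num
    rw [hexp2, hu]
    nth_rewrite 2 [← Real.sq_sqrt hp.le]
    field_simp
  calc (p + 1 / l ^ 2) ^ k * Real.exp (l * √p) ^ (2 * m)
      ≤ (p / u ^ 2 * (1 + u ^ 2)) ^ k * Real.exp (2 * (1 - u)) ^ k := by rw [hadd]; gcongr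
    _ = (p / u ^ 2 * ((1 + u ^ 2) * Real.exp (2 * (1 - u)))) ^ k := by rw [← mul_pow, mul_assoc]
    _ ≤ (p / u ^ 2 * Real.exp 2) ^ k := by gcongr; exact one_add_sq_mul_exp_le hu0.le
    _ = _ := by rw [exp_neg_two_mul_log (by positivity), htarget]

end Bound

end

end ChainOfPoWs

open ChainOfPoWs in
theorem theorem2_general {κ N q k T : ℕ} (hT : 0 < T) {Y W : Type*} [Fintype Y] [Fintype W]
    (x₀ : BitVec κ) (A : Adversary N κ Y W) (hA : A.queries ≤ q) (p : ℝ)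
    (hp : p = (T : ℝ) / 2 ^ κ) :
    successProb A T x₀ k ≤
      Real.exp (-2 * (k : ℝ) *
        Real.log ((k : ℝ) / (Real.exp 1 * ((q : ℝ) + (k : ℝ))) * (1 / Real.sqrt p))) := by
  have hp0 : 0 < p := by rw [hp]; positivity
  set x : ℝ := k / (Real.exp 1 * (q + k)) * (1 / √p) with hx
  obtain hx1 | hx1 := le_or_gt x 1
  · have hlog : Real.log x ≤ 0 := Real.log_nonpos (by positivity) hx1
    exact (successProb_le_one A T x₀ k).trans
      (Real.one_le_exp (mul_nonneg_of_nonpos_of_nonpos (by simp) hlog))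
  have hk : k ≠ 0 := by
    rintro rfl
    norm_num [hx] at hx1
  set l : ℝ := k / ((q + k) * √p) with hl
  have hxl : Real.exp 1 * x = l := by rw [hx, hl]; field_simp
  have hl1 : 1 < l := by nlinarith [Real.one_lt_exp_iff.2 one_pos]
  have hlp : l * √p = k / (q + k) := by rw [hl]; field_simp
  have hp1 : p < 1 := by
    have hsqrt : √p < l * √p := lt_mul_of_one_lt_left (Real.sqrt_pos.2 hp0) hl1
    have hlp1 : l * √p ≤ 1 := hlp.trans_le (div_le_one_of_le₀ (by simp) (by positivity))
    simpa using (Real.sqrt_lt' one_pos).1 (hsqrt.trans_le hlp1)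
  have hTκ : T ≤ 2 ^ κ := by
    rw [hp, div_lt_one (by positivity)] at hp1
    exact_mod_cast hp1.le
  have hdensity : density (target κ T) = p := (density_target hTκ).trans hp.symm
  have hsucc := successProb_le A (hdensity.trans_lt hp1) hl1.le x₀ k
  rw [hdensity] at hsucc
  exact hsucc.trans (add_pow_mul_exp_pow_le hp0 hk hA hl)

theorem theorem2 {κ N k T : ℕ} (hT : 0 < T) (hTκ : T ≤ 2 ^ κ)
    {Y W : Type*} [Fintype Y] [Fintype W] (x₀ : BitVec κ)
    (A : ChainOfPoWs.Adversary N κ Y W) (hA : A.queries ≤ N)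
    (p : ℝ) (hp : p = (T : ℝ) / 2 ^ κ) :
    ChainOfPoWs.successProb A T x₀ k ≤
      Real.exp (-2 * (k : ℝ) *
        Real.log ((k : ℝ) / (Real.exp 1 * ((N : ℝ) + (k : ℝ))) * (1 / Real.sqrt p))) :=
  theorem2_general hT x₀ A hA p hp
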